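/- Let $\mathcal L$ be a nonempty finite distributive lattice with order $<$, let $P\subset\mathcal L$ be its poset of join-irreducible elements, and let \[O(P,<)=\{x\in\mathbb R^P : 0\le x_p\le 1 \text{ for all } p,\ x_p\le x_q \text{ whenever } p>q\}\] be its order polytope. The vertices of $O(P,<)$ are the points $v_a$, $a\in\mathcal L$, where $v_a$ is the indicator function of $\{p\in P: p\le a\}$, and $a\mapsto v_a$ is a bijection from $\mathcal L$ to the vertex set $V$. Let $\psi:\mathbb R^{\mathcal L}\to\mathbb R^V$ be the induced linear isomorphism, $\psi(w)_{v_a}=w_a$. *Gröbner fans.* For an ideal $I$ of a polynomial ring over $\mathbb C$ in finitely many variables $X_i$ and a real weight vector $w$, let $\mathrm{in}_w I$ be the ideal generated by the initial parts $\mathrm{in}_w p$, $p\in I$, where $\mathrm{in}_w p$ is the sum of the terms of $p$ of least weight, $X_i$ having weight $w_i$. Let $C(I,J)$ be the set of all $w$ with $\mathrm{in}_w I=J$. The nonempty sets $C(I,J)$ are the (relatively open) cones of the Gröbner fan of $I$. In $\mathbb C[X_a : a\in\mathcal L]$ let $I^h$ be the Hibi ideal, generated by $X_aX_b-X_{a\vee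 b}X_{a\wedge b}$ for all $a,b\in\mathcal L$, and let $I^m$ be the ideal generated by $X_aX_b$ for all incomparable $a,b\in\mathcal L$. The toric ideal of $O(P,<)$ is the kernel of the homomorphism $\mathbb C[X_v : v\in V]\to\mathbb C[t,z_p : p\in P]$, $X_v\mapsto t\prod_p z_p^{v_p}$. *Secondary fan.* Let $Q\subset\mathbb R^n$ be an $n$-dimensional polytope with vertex set $V$. For $c\in\mathbb R^V$ let $T\subset\mathbb R^n\times\mathbb R$ be the convex hull of the rays $\{v\}\times(-\infty,c_v]$, $v\in V$. The regular subdivision $\Theta_Q(c)$ is the set of projections to $\mathbb R^n$ of the bounded facets of $T$. For a regular subdivision $\Theta$ let $C(\Theta)=\{c:\Theta_Q(c)=\Theta\}$. The sets $C(\Theta)$ are the (relatively open) cones of the secondary fan of $Q$. In either fan, a cone is called maximal if its closure is not contained in the closure of any other cone of the fan. **Claim.** The cone $\psi(C(I^h,I^m))$ is a maximal cone of the secondary fan of $O(P,<)$. Moreover, $\psi(C(I^h,I^m))$ is a maximal cone of the Gröbner fan of the toric ideal of $O(P,<)$, and $C(I^h,I^m)$ is a maximal cone of the Gröbner fan of $I^h$.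 In particular, the Gröbner fan of the toric ideal and the secondary fan share this maximal cone. -/

import Mathlib

noncomputable section

namespace HibiSecondary

open MvPolynomial

/-! ### Fans given by their relatively open cones -/

/-- A fan is recorded by the set of its relatively open cones.  A member is a maximal cone of the
fan if its closure is not contained in the closure of any other member. -/
def IsMaximalCone {E : Type*} [TopologicalSpace E] (fan : Set (Set E)) (C : Set E) : Prop :=
  C ∈ fan ∧ ∀ D ∈ fan, closure C ⊆ closure D → C = D

/-! ### Initial ideals and the Groebner fan (minimum convention) -/

section Groebner

variable {σ : Type*}

open Classical in
/-- The initial part of `p` with respect to `w`: the sum of those terms `c X ^ d` of `p` for which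
the weight `∑ i, d i * w i` is the least possible. -/
def initialForm (w : σ → ℝ) (p : MvPolynomial σ ℂ) : MvPolynomial σ ℂ :=
  ∑ d ∈ p.support.filter (fun d => ∀ e ∈ p.support, Finsupp.weight w d ≤ Finsupp.weight w e),
    monomial d (p.coeff d)

/-- The initial ideal, generated by the initial parts of all elements of `I`.  (The initial parts
span an ideal already as a vector space, since a monomial times an initial part is one again.) -/
def initialIdeal (w : σ → ℝ) (I : Ideal (MvPolynomial σ ℂ)) : Ideal (MvPolynomial σ ℂ) :=
  Ideal.span (initialForm w '' (I : Set (MvPolynomial σ ℂ)))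

/-- The cone `C(I, J)` of all weights for which `J` is the initial ideal of `I`. -/
def groebnerCone (I J : Ideal (MvPolynomial σ ℂ)) : Set (σ → ℝ) :=
  {w | initialIdeal w I = J}

/-- The Groebner fan of `I`: all nonempty cones `C(I, J)`. -/
def groebnerFan (I : Ideal (MvPolynomial σ ℂ)) : Set (Set (σ → ℝ)) :=
  {C | C.Nonempty ∧ ∃ J, C = groebnerCone I J}

end Groebner

/-! ### Toric ideals -/

/-- The toric ideal of a set of points `V`: the kernel of the homomorphism from the polynomial
ring in variables `X_v`, `v ∈ V`, sending `X_v` to `t * z ^ v`.  The element `t ^ k * z ^ u` is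
the basis element of the monoid algebra at `(u, k)`; if the points of `V` are integral, the image
lies in the subring of Laurent polynomials in `z` and `t`. -/
def toricIdeal {E : Type*} [AddCommGroup E] (V : Set E) : Ideal (MvPolynomial V ℂ) :=
  RingHom.ker (aeval (fun v : V => AddMonoidAlgebra.single ((v : E), (1 : ℕ)) (1 : ℂ)) :
    MvPolynomial V ℂ →ₐ[ℂ] AddMonoidAlgebra ℂ (E × ℕ))

/-! ### Regular subdivisions and the secondary fan -/

section Secondary

/-- `F` is a facet of the polyhedron `T`: a nonempty face of codimension one. -/
def IsFacet {M : Type*} [AddCommGroup M] [Module ℝ M] [TopologicalSpace M] (T F : Set M) : Prop :=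
  F.Nonempty ∧ IsExposed ℝ T F ∧
    Module.finrank ℝ (vectorSpan ℝ F) + 1 = Module.finrank ℝ (vectorSpan ℝ T)

variable {ι : Type*}

/-- The set of vertices of a polytope. -/
def vertices (Q : Set (ι → ℝ)) : Set (ι → ℝ) := Q.extremePoints ℝ

/-- The convex hull `T` of the downward rays `{v} × (-∞, c v]`, `v` a vertex of `Q`. -/
def hypograph (Q : Set (ι → ℝ)) (c : vertices Q → ℝ) : Set ((ι → ℝ) × ℝ) :=
  convexHull ℝ {y | ∃ v : vertices Q, y.1 = v ∧ y.2 ≤ c v}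

/-- The regular subdivision of `Q` given by `c`: the set of projections to the space of `Q` of
the bounded facets of `hypograph Q c`.  The polytope `Q` is to be full-dimensional. -/
def regularSubdivision (Q : Set (ι → ℝ)) (c : vertices Q → ℝ) : Set (Set (ι → ℝ)) :=
  {D | ∃ F, IsFacet (hypograph Q c) F ∧ Bornology.IsBounded F ∧ D = Prod.fst '' F}

/-- The cone `C(Θ)` of all `c` which give the regular subdivision `Θ`. -/
def secondaryCone (Q : Set (ι → ℝ)) (Θ : Set (Set (ι → ℝ))) :
    Set (vertices Q → ℝ) :=
  {c | regularSubdivision Q c = Θ}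

/-- The secondary fan of `Q`: the cones `C(Θ)` of all regular subdivisions `Θ` of `Q`. -/
def secondaryFan (Q : Set (ι → ℝ)) : Set (Set (vertices Q → ℝ)) :=
  {C | ∃ Θ, (∃ c, regularSubdivision Q c = Θ) ∧ C = secondaryCone Q Θ}

end Secondary

/-! ### Order polytopes -/

/-- The order polytope, with order ideals (lower sets) as vertices. -/
def orderPolytope (P : Type*) [PartialOrder P] : Set (P → ℝ) :=
  {x | (∀ p, 0 ≤ x p ∧ x p ≤ 1) ∧ ∀ p q, q < p → x p ≤ x q}

/-! ### Finite distributive lattices -/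

section Lattice

variable (L : Type*) [DistribLattice L]

/-- The poset of join-irreducible elements. -/
abbrev JoinIrr : Type _ := {p : L // SupIrred p}

/-- The Hibi ideal, generated by all `X a * X b - X (a ⊔ b) * X (a ⊓ b)`. -/
def hibiIdeal : Ideal (MvPolynomial L ℂ) :=
  Ideal.span {f | ∃ a b : L, f = X a * X b - X (a ⊔ b) * X (a ⊓ b)}

/-- The monomial ideal generated by the products `X a * X b` with `a`, `b` incomparable. -/
def monomialIdeal : Ideal (MvPolynomial L ℂ) :=
  Ideal.span {f | ∃ a b : L, ¬ a ≤ b ∧ ¬ b ≤ a ∧ f = X a * X b}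

variable {L}

open Classical in
/-- The point `v_a`: the indicator function of the order ideal of all join-irreducible `p ≤ a`. -/
def latticePoint (a : L) : JoinIrr L → ℝ := fun p => if (p : L) ≤ a then 1 else 0

theorem latticePoint_mem (a : L) : latticePoint a ∈ vertices (orderPolytope (JoinIrr L)) := by
  have hmem : latticePoint a ∈ orderPolytope (JoinIrr L) := by
    refine ⟨fun p => ?_, fun p q hqp => ?_⟩
    · unfold latticePoint; split_ifs <;> norm_num
    · have h : (q : L) ≤ p := hqp.le
      unfold latticePoint
      split_ifs with h1 h2 h2
      · exact le_rfl
      · exact absurd (h.trans h1) h2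
      · norm_num
      · exact le_rfl
  refine mem_extremePoints.2 ⟨hmem, ?_⟩
  rintro x hx y hy ⟨s, t, hs, ht, hst, hxy⟩
  have key : ∀ p, x p = latticePoint a p ∧ y p = latticePoint a p := by
    intro p
    have e : s * x p + t * y p = latticePoint a p := by
      have := congrFun hxy p
      simpa using this
    have hx0 := hx.1 p
    have hy0 := hy.1 p
    unfold latticePoint at e ⊢
    split_ifs at e ⊢
    · constructor <;> nlinarith
    · constructor <;> nlinarith
  exact ⟨funext fun p => (key p).1, funext fun p => (key p).2⟩

variable [Finite L] [Nonempty L]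

theorem latticePoint_bijective :
    Function.Bijective (fun a : L =>
      (⟨latticePoint a, latticePoint_mem a⟩ : vertices (orderPolytope (JoinIrr L)))) := by
  classical
  let _ : Fintype L := Fintype.ofFinite L
  let _ : OrderBot L := Fintype.toOrderBot L
  constructor
  · intro a b hab
    have h : latticePoint a = latticePoint b := congrArg Subtype.val hab
    apply (OrderIso.lowerSetSupIrred (α := L)).injective
    apply SetLike.coe_injective
    ext p
    have hp := congrFun h p
    change (p : L) ≤ a ↔ (p : L) ≤ b
    unfold latticePoint at hp
    split_ifs at hp with h1 h2 h2 <;> simp_all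
  · rintro ⟨x, hx⟩
    obtain ⟨hxO, hext⟩ := mem_extremePoints.1 hx
    have h01 : ∀ p, x p = 0 ∨ x p = 1 := by
      have hy : (fun p => x p ^ 2) ∈ orderPolytope (JoinIrr L) := by
        refine ⟨fun p => ?_, fun p q hqp => ?_⟩
        · have := hxO.1 p
          constructor <;> nlinarith
        · have h1 := hxO.2 p q hqp
          have := hxO.1 p
          have := hxO.1 q
          change x p ^ 2 ≤ x q ^ 2
          nlinarith
      have hz : (fun p => 2 * x p - x p ^ 2) ∈ orderPolytope (JoinIrr L) := by
        refine ⟨fun p => ?_, fun p q hqp => ?_⟩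
        · have := hxO.1 p
          constructor <;> nlinarith
        · have h1 := hxO.2 p q hqp
          have := hxO.1 p
          have := hxO.1 q
          change 2 * x p - x p ^ 2 ≤ 2 * x q - x q ^ 2
          nlinarith
      have hs : x ∈ openSegment ℝ (fun p => x p ^ 2) (fun p => 2 * x p - x p ^ 2) := by
        refine ⟨1 / 2, 1 / 2, by norm_num, by norm_num, by norm_num, ?_⟩
        funext p
        simp only [Pi.add_apply, Pi.smul_apply, smul_eq_mul]
        ring
      intro p
      have e := congrFun (hext _ hy _ hz hs).1 p
      have e' : x p * (x p - 1) = 0 := by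
        have : x p ^ 2 = x p := e
        nlinarith
      rcases mul_eq_zero.1 e' with h | h
      · exact Or.inl h
      · exact Or.inr (by linarith)
    let S : LowerSet (JoinIrr L) := ⟨{p | x p = 1}, by
      intro p q hqp hp
      rcases hqp.lt_or_eq with h | h
      · have h1 := hxO.2 p q h
        have h2 := (hxO.1 q).2
        have h3 : x p = 1 := hp
        change x q = 1
        linarith
      · rw [h]; exact hp⟩
    obtain ⟨a, ha⟩ := (OrderIso.lowerSetSupIrred (α := L)).surjective S
    refine ⟨a, Subtype.ext (funext fun p => ?_)⟩
    have hp : (p : L) ≤ a ↔ x p = 1 := by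
      have : p ∈ OrderIso.lowerSetSupIrred a ↔ p ∈ S := by rw [ha]
      exact this
    change latticePoint a p = x p
    unfold latticePoint
    split_ifs with h
    · exact (hp.1 h).symm
    · rcases h01 p with h0 | h1
      · exact h0.symm
      · exact absurd (hp.2 h1) h

variable (L)

/-- The bijection `a ↦ v_a` from the lattice to the vertices of the order polytope. -/
def vertexEquiv : L ≃ vertices (orderPolytope (JoinIrr L)) :=
  Equiv.ofBijective _ latticePoint_bijective

/-- The linear isomorphism induced by `a ↦ v_a`: `psi L w` has the value `w a` at `v_a`. -/
def psi : (L → ℝ) ≃ₗ[ℝ] (vertices (orderPolytope (JoinIrr L)) → ℝ) :=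
  LinearEquiv.funCongrLeft ℝ ℝ (vertexEquiv L).symm

end Lattice

end HibiSecondary

end

namespace HibiSecondary

/-! Both the Gröbner cone and, after `psi`, the secondary cone consist of the strictly supermodular
weights `w`. This set is open and nonempty, and distinct cones of either fan are disjoint, which
gives maximality (`isMaximalCone_of_isOpen`).

The common core is `exists_linear_tight`: for such `w` and a maximal chain `M`, some affine function
equals `w` on `M` and strictly exceeds it off `M`. Affine functions are modular along `a ↦ v_a`,
because `v_(a ⊔ b) + v_(a ⊓ b) = v_a + v_b`.

Geometrically, the bounded facets of the hypograph lie over the simplices of maximal chains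
(`regularSubdivision_psi`). Algebraically, among monomials with one image in the toric ring, the one
supported on a chain has strictly largest weight (`weight_lt_of_isChain`). So no chain monomial is
initial under the minimum convention, and the initial ideal is `monomialIdeal L`. Conversely, either
the chain triangulation or this initial ideal forces every supermodular inequality. The same weight
comparison identifies the Hibi ideal with the toric ideal (`hibiIdeal_eq_ker`). -/

/-- Strict supermodularity of a function on a lattice. -/
def StrictSupermodular {L : Type*} [Lattice L] (w : L → ℝ) : Prop :=
  ∀ a b : L, ¬ a ≤ b → ¬ b ≤ a → w a + w b < w (a ⊔ b) + w (a ⊓ b)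

/-! ### Maximal chains and affine functions on the points `v_a`. -/

section Lattice

variable {L : Type*} [DistribLattice L]

/-- Join-irreducibles of a distributive lattice are join-prime. Both the Hibi relations and the
modularity of affine functions come from this identity. -/
theorem latticePoint_sup_add_inf (a b : L) :
    latticePoint (a ⊔ b) + latticePoint (a ⊓ b) = latticePoint a + latticePoint b := by
  funext p
  have h : (p : L) ≤ a ⊔ b ↔ (p : L) ≤ a ∨ (p : L) ≤ b := p.2.supPrime.le_sup
  simp only [Pi.add_apply, latticePoint, le_inf_iff]
  by_cases h1 : (p : L) ≤ a <;> by_cases h2 : (p : L) ≤ b <;> simp [h, h1, h2]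

theorem map_latticePoint_sup_add_inf (y : (JoinIrr L → ℝ) →ₗ[ℝ] ℝ) (a b : L) :
    y (latticePoint (a ⊔ b)) + y (latticePoint (a ⊓ b)) =
      y (latticePoint a) + y (latticePoint b) := by
  rw [← map_add, latticePoint_sup_add_inf, map_add]

theorem IsMaxChain.mem_of_forall_comparable {M : Set L} (hM : IsMaxChain (· ≤ ·) M) {a : L}
    (h : ∀ x ∈ M, a ≤ x ∨ x ≤ a) : a ∈ M := by
  have h1 : IsChain (· ≤ ·) (insert a M) := hM.1.insert fun x hx _ => h x hx
  rw [hM.2 h1 (Set.subset_insert a M)]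
  exact Set.mem_insert a M

variable [Finite L]

theorem exists_joinIrr_le_not_le {a b : L} (h : ¬ b ≤ a) :
    ∃ p : JoinIrr L, (p : L) ≤ b ∧ ¬ (p : L) ≤ a := by
  classical
  let _ : Fintype L := Fintype.ofFinite L
  have : Nonempty L := ⟨a⟩
  let _ : OrderBot L := Fintype.toOrderBot L
  by_contra! hc
  apply h
  rw [← (OrderIso.lowerSetSupIrred (α := L)).le_iff_le]
  intro p hp
  exact hc p hp

/-- The points of a chain are affinely independent: each element has a join-irreducible below it
that is not below its predecessor, so values can be prescribed from the bottom up. -/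
theorem exists_linear_eqOn_chain {M : Set L} (hM : IsChain (· ≤ ·) M) (f : L → ℝ) :
    ∃ (y : (JoinIrr L → ℝ) →ₗ[ℝ] ℝ) (k : ℝ), ∀ a ∈ M, f a = k + y (latticePoint a) := by
  classical
  lift M to Finset L using M.toFinite
  induction M using Finset.strongInduction with
  | H M ih =>
    rcases M.eq_empty_or_nonempty with rfl | hne
    · exact ⟨0, 0, by simp⟩
    obtain ⟨m, hm⟩ := M.exists_maximal hne
    obtain ⟨y, k, hyk⟩ := ih (M.erase m) (Finset.erase_ssubset hm.1)
      (hM.mono (by simp))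
    rcases (M.erase m).eq_empty_or_nonempty with he | hne'
    · refine ⟨0, f m, fun a ha => ?_⟩
      have : a = m := by
        by_contra h
        exact Finset.notMem_empty a (he ▸ Finset.mem_erase.2 ⟨h, ha⟩)
      simp [this]
    · obtain ⟨x, hx⟩ := (M.erase m).exists_maximal hne'
      have hxM := Finset.mem_of_mem_erase hx.1
      have hmx : ¬ m ≤ x := fun h =>
        Finset.ne_of_mem_erase hx.1 (le_antisymm (hM.total hxM hm.1 |>.elim id (hm.2 hxM)) h)
      obtain ⟨p, hpm, hpx⟩ := exists_joinIrr_le_not_le hmx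
      -- The coordinate `p` is `1` at `m` and `0` at all smaller chain elements, so it corrects the
      -- value at `m` alone.
      refine ⟨y + (f m - k - y (latticePoint m)) • LinearMap.proj p, k, fun a ha => ?_⟩
      by_cases ham : a = m
      · subst ham
        simp [latticePoint, hpm]
      · have ha' : a ∈ M.erase m := Finset.mem_erase.2 ⟨ham, ha⟩
        have hax : a ≤ x := (hM.total ha hxM).elim id (hx.2 ha')
        have hpa : ¬ (p : L) ≤ a := fun h => hpx (h.trans hax)
        rw [hyk a ha']
        simp [latticePoint, hpa]

/-- Downward induction on `b ∉ M`. For `m` minimal in `M` with `¬ m ≤ b`, maximality of the chain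
puts `b ⊓ m` in `M`, and `b ⊔ m` lies strictly above `b`. Supermodularity of `w` against modularity
of the affine function then gives the bound at `b`. -/
theorem exists_linear_tight {w : L → ℝ} (hw : StrictSupermodular w) {M : Set L}
    (hM : IsMaxChain (· ≤ ·) M) :
    ∃ (y : (JoinIrr L → ℝ) →ₗ[ℝ] ℝ) (k : ℝ), (∀ a ∈ M, w a = k + y (latticePoint a)) ∧
      ∀ a ∉ M, w a < k + y (latticePoint a) := by
  obtain ⟨y, k, hyk⟩ := exists_linear_eqOn_chain hM.1 w
  refine ⟨y, k, hyk, fun b => ?_⟩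
  induction b using WellFoundedGT.induction with
  | ind b ih =>
    intro hb
    have hne : {x | x ∈ M ∧ ¬ x ≤ b}.Nonempty := by
      by_contra hc
      rw [Set.not_nonempty_iff_eq_empty] at hc
      refine hb (IsMaxChain.mem_of_forall_comparable hM fun x hx => Or.inr ?_)
      by_contra hxb
      exact (Set.eq_empty_iff_forall_notMem.1 hc) x ⟨hx, hxb⟩
    obtain ⟨m, hm⟩ := (Set.toFinite _).exists_minimal hne
    have hmem : b ⊓ m ∈ M := by
      refine IsMaxChain.mem_of_forall_comparable hM fun x hx => ?_
      rcases hM.1.total hx hm.1.1 with h | h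
      · by_cases hxb : x ≤ b
        · exact Or.inr (le_inf hxb h)
        · exact Or.inl (inf_le_right.trans (hm.2 ⟨hx, hxb⟩ h))
      · exact Or.inl (inf_le_right.trans h)
    have hbm : ¬ b ≤ m := fun h => hb (by rwa [inf_eq_left.2 h] at hmem)
    have h1 := hw b m hbm hm.1.2
    have h2 := map_latticePoint_sup_add_inf y b m
    have h3 := hyk _ hm.1.1
    have h4 := hyk _ hmem
    have h5 : w (b ⊔ m) ≤ k + y (latticePoint (b ⊔ m)) := by
      by_cases h : b ⊔ m ∈ M
      · exact (hyk _ h).le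
      · exact (ih _ (lt_of_le_of_ne le_sup_left fun e => hm.1.2 (e ▸ le_sup_right)) h).le
    linarith

/-- For each `p`, let `t` be the least chain element above `p` and `s` the greatest one not above
it. Maximality leaves `p` as the only join-irreducible below `t` but not below `s`, so `v_t - v_s`
is the basis vector at `p`. -/
theorem vectorSpan_latticePoint_eq_top [Nonempty L] {M : Set L} (hM : IsMaxChain (· ≤ ·) M) :
    vectorSpan ℝ (latticePoint '' M) = ⊤ := by
  classical
  let _ : Fintype L := Fintype.ofFinite L
  let _ : OrderBot L := Fintype.toOrderBot L
  let _ : OrderTop L := Fintype.toOrderTop L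
  rw [eq_top_iff, ← (Pi.basisFun ℝ (JoinIrr L)).span_eq, Submodule.span_le]
  rintro _ ⟨p, rfl⟩
  have hn : {x | x ∈ M ∧ (p : L) ≤ x}.Nonempty := ⟨⊤, hM.top_mem, le_top⟩
  have hn' : {x | x ∈ M ∧ ¬ (p : L) ≤ x}.Nonempty :=
    ⟨⊥, hM.bot_mem, fun h => p.2.1 (le_bot_iff.1 h ▸ isMin_bot)⟩
  obtain ⟨t, ht⟩ := (Set.toFinite _).exists_minimal hn
  obtain ⟨s, hs⟩ := (Set.toFinite _).exists_maximal hn'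
  have ht' : ∀ x ∈ M, (p : L) ≤ x → t ≤ x := fun x hx hp => by
    rcases hM.1.total ht.1.1 hx with h | h
    · exact h
    · exact ht.2 ⟨hx, hp⟩ h
  have hs' : ∀ x ∈ M, ¬ (p : L) ≤ x → x ≤ s := fun x hx hp => by
    rcases hM.1.total hs.1.1 hx with h | h
    · exact hs.2 ⟨hx, hp⟩ h
    · exact h
  have hst : s ≤ t := by
    rcases hM.1.total hs.1.1 ht.1.1 with h | h
    · exact h
    · exact absurd (ht.1.2.trans h) hs.1.2
  have hmem : ∀ q ≤ t, s ⊔ q ∈ M := fun q hq => by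
    refine IsMaxChain.mem_of_forall_comparable hM fun x hx => ?_
    by_cases hp : (p : L) ≤ x
    · exact Or.inl ((sup_le hst hq).trans (ht' x hx hp))
    · exact Or.inr ((hs' x hx hp).trans le_sup_left)
  have hpq : ∀ q : JoinIrr L, (q : L) ≤ t → ¬ (q : L) ≤ s → q = p := fun q hq hqs => by
    refine Subtype.ext (le_antisymm ?_ ?_)
    · have h := hq.trans (ht' _ (hmem _ ht.1.2) le_sup_right)
      exact (q.2.supPrime.le_sup.1 h).resolve_left hqs
    · have h : (p : L) ≤ s ⊔ q := by
        by_contra hc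
        exact hqs (le_sup_right.trans (hs' _ (hmem _ hq) hc))
      exact (p.2.supPrime.le_sup.1 h).resolve_left hs.1.2
  have key : Pi.basisFun ℝ (JoinIrr L) p = latticePoint t - latticePoint s := by
    funext q
    by_cases h : q = p
    · subst h
      simp [latticePoint, ht.1.2, hs.1.2]
    · simp only [Pi.basisFun_apply, Pi.sub_apply, latticePoint, Pi.single_apply, h, if_false]
      by_cases h1 : (q : L) ≤ t
      · by_cases h2 : (q : L) ≤ s
        · simp [h1, h2]
        · exact absurd (hpq q h1 h2) h
      · have h2 : ¬ (q : L) ≤ s := fun h2 => h1 (h2.trans hst)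
        simp [h1, h2]
  rw [key]
  exact vsub_mem_vectorSpan ℝ ⟨t, ht.1.1, rfl⟩ ⟨s, hs.1.1, rfl⟩

/-- The number `h a` of join-irreducibles below `a` is modular and strictly monotone. For `h ^ 2`
the supermodular gap is `2 (h a - h (a ⊓ b)) (h b - h (a ⊓ b))`. -/
theorem exists_strictSupermodular : ∃ w : L → ℝ, StrictSupermodular w := by
  classical
  let _ : Fintype (JoinIrr L) := Fintype.ofFinite _
  let h : L → ℝ := fun a => ∑ p, latticePoint a p
  have hmono : ∀ a b : L, ¬ b ≤ a → h (a ⊓ b) < h b := fun a b hab => by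
    obtain ⟨p, hp, hpa⟩ := exists_joinIrr_le_not_le hab
    refine Finset.sum_lt_sum (fun q _ => ?_) ⟨p, Finset.mem_univ p, ?_⟩
    · simp only [latticePoint, le_inf_iff]
      split_ifs <;> simp_all
    · simp [latticePoint, hp, hpa]
  refine ⟨fun a => h a ^ 2, fun a b hab hba => ?_⟩
  have h1 := hmono a b hba
  have h2 := hmono b a hab
  rw [inf_comm] at h2
  have h3 : h (a ⊔ b) = h a + h b - h (a ⊓ b) := by
    rw [eq_sub_iff_add_eq]
    simp only [h, ← Finset.sum_add_distrib]
    exact Finset.sum_congr rfl fun p _ => congrFun (latticePoint_sup_add_inf a b) p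
  simp only [h3]
  nlinarith [mul_pos (sub_pos.2 h1) (sub_pos.2 h2)]

end Lattice

end HibiSecondary

namespace HibiSecondary

open MvPolynomial

/-! ### Kernels of monomial homomorphisms. -/

section ExponentHom

variable {σ M : Type*} [AddCommMonoid M]

/-- The homomorphism to a monoid algebra sending the variable `X i` to the basis element `g i`. -/
noncomputable def exponentHom (g : σ → M) : MvPolynomial σ ℂ →ₐ[ℂ] AddMonoidAlgebra ℂ M :=
  aeval fun i => AddMonoidAlgebra.single (g i) 1

theorem exponentHom_monomial (g : σ → M) (d : σ →₀ ℕ) (c : ℂ) :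
    exponentHom g (monomial d c) = AddMonoidAlgebra.single (Finsupp.weight g d) c := by
  rw [exponentHom, aeval_monomial, Finsupp.prod]
  simp only [AddMonoidAlgebra.single_pow, AddMonoidAlgebra.prod_single, one_pow,
    Finset.prod_const_one, AddMonoidAlgebra.coe_algebraMap, Function.comp_apply,
    Algebra.algebraMap_self, RingHom.id_apply, AddMonoidAlgebra.single_mul_single, zero_add, mul_one]
  rfl

/-- Monomials map to basis elements, so each term of a kernel element must cancel against another
with the same image. -/
theorem exists_ne_mem_support_of_exponentHom_eq_zero {g : σ → M} {f : MvPolynomial σ ℂ}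
    (hf : exponentHom g f = 0) {s : σ →₀ ℕ} (hs : s ∈ f.support) :
    ∃ d ∈ f.support, d ≠ s ∧ Finsupp.weight g d = Finsupp.weight g s := by
  classical
  by_contra! hc
  rw [f.as_sum, map_sum] at hf
  have h := congrArg (fun x => AddMonoidAlgebra.coeff x (Finsupp.weight g s)) hf
  simp only [exponentHom_monomial, AddMonoidAlgebra.coeff_sum, AddMonoidAlgebra.coeff_single,
    Finsupp.finsetSum_apply, AddMonoidAlgebra.coeff_zero, Finsupp.coe_zero, Pi.zero_apply] at h
  rw [Finset.sum_eq_single_of_mem s hs fun d hd hds =>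
    Finsupp.single_eq_of_ne (hc d hd hds).symm, Finsupp.single_eq_same] at h
  exact mem_support_iff.1 hs h

/-- The kernel is spanned by binomials: subtracting a multiple of one removes the term `s` and only
alters the term `d` already present, so the number of terms drops. -/
theorem ker_exponentHom_le {g : σ → M} {I : Ideal (MvPolynomial σ ℂ)}
    (hI : ∀ d e : σ →₀ ℕ, Finsupp.weight g d = Finsupp.weight g e →
      monomial d (1 : ℂ) - monomial e 1 ∈ I) :
    RingHom.ker (exponentHom g) ≤ I := by
  classical
  intro f hf
  induction hn : f.support.card using Nat.strong_induction_on generalizing f with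
  | _ n ih =>
    rcases f.support.eq_empty_or_nonempty with h0 | ⟨s, hs⟩
    · rw [support_eq_empty.1 h0]
      exact I.zero_mem
    obtain ⟨d, hd, hds, hdeg⟩ := exists_ne_mem_support_of_exponentHom_eq_zero hf hs
    set b : MvPolynomial σ ℂ := C (f.coeff s) * (monomial s 1 - monomial d 1) with hb
    have hbI : b ∈ I := I.mul_mem_left _ (hI _ _ hdeg.symm)
    have hbk : exponentHom g b = 0 := by
      rw [hb, map_mul, map_sub, exponentHom_monomial, exponentHom_monomial, hdeg, sub_self,
        mul_zero]
    have hbc : ∀ e, b.coeff e = f.coeff s * ((if s = e then 1 else 0) - if d = e then 1 else 0) :=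
      fun e => by rw [hb, coeff_C_mul, coeff_sub, coeff_monomial, coeff_monomial]
    have hsub : (f - b).support ⊆ f.support.erase s := by
      intro e he
      rw [mem_support_iff, coeff_sub, hbc] at he
      refine Finset.mem_erase.2 ⟨?_, ?_⟩
      · rintro rfl
        simp [hds] at he
      · by_contra hef
        have h1 : s ≠ e := fun h => hef (h ▸ hs)
        have h2 : d ≠ e := fun h => hef (h ▸ hd)
        rw [notMem_support_iff] at hef
        simp [hef, h1, h2] at he
    have hlt : (f - b).support.card < n :=
      hn ▸ (Finset.card_le_card hsub).trans_lt (Finset.card_erase_lt_of_mem hs)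
    have h := ih _ hlt (f := f - b) (by
      rw [RingHom.mem_ker] at hf ⊢
      rw [map_sub, hf, hbk, sub_zero]) rfl
    have := I.add_mem h hbI
    rwa [sub_add_cancel] at this

end ExponentHom

/-! ### Initial ideals and renaming of variables. -/

section InitialForm

variable {σ τ : Type*}

open Classical in
theorem coeff_initialForm (w : σ → ℝ) (f : MvPolynomial σ ℂ) (d : σ →₀ ℕ) :
    (initialForm w f).coeff d =
      if ∀ e ∈ f.support, Finsupp.weight w d ≤ Finsupp.weight w e then f.coeff d else 0 := by
  rw [initialForm, coeff_sum]
  simp only [coeff_monomial, Finset.sum_ite_eq', Finset.mem_filter, mem_support_iff]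
  by_cases h : f.coeff d = 0 <;> simp [h]

theorem mem_support_initialForm {w : σ → ℝ} {f : MvPolynomial σ ℂ} {d : σ →₀ ℕ} :
    d ∈ (initialForm w f).support ↔
      d ∈ f.support ∧ ∀ e ∈ f.support, Finsupp.weight w d ≤ Finsupp.weight w e := by
  rw [mem_support_iff, coeff_initialForm, mem_support_iff]
  by_cases h : ∀ e ∈ f.support, Finsupp.weight w d ≤ Finsupp.weight w e
  · rw [if_pos h]
    exact ⟨fun h1 => ⟨h1, h⟩, And.left⟩
  · rw [if_neg h]
    exact ⟨fun h1 => absurd rfl h1, fun h1 => absurd h1.2 h⟩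

theorem initialForm_rename (e : σ ≃ τ) (w : σ → ℝ) (f : MvPolynomial σ ℂ) :
    initialForm (w ∘ e.symm) (renameEquiv ℂ e f) = renameEquiv ℂ e (initialForm w f) := by
  classical
  have hw : ∀ d : σ →₀ ℕ, Finsupp.weight (w ∘ e.symm) (d.mapDomain e) = Finsupp.weight w d := by
    intro d
    rw [Finsupp.weight_apply, Finsupp.weight_apply,
      Finsupp.sum_mapDomain_index (by simp) fun _ _ _ => add_smul _ _ _]
    simp
  have hinj := Finsupp.mapDomain_injective (M := ℕ) e.injective
  ext d
  obtain ⟨d, rfl⟩ : ∃ d', d'.mapDomain e = d :=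
    ⟨d.mapDomain e.symm, by rw [← Finsupp.mapDomain_comp]; simp⟩
  simp only [renameEquiv_apply, coeff_initialForm, coeff_rename_mapDomain e e.injective, hw,
    support_rename_of_injective e.injective, Finset.forall_mem_image]

theorem initialIdeal_map_rename (e : σ ≃ τ) (w : σ → ℝ) (I : Ideal (MvPolynomial σ ℂ)) :
    initialIdeal (w ∘ e.symm) (I.map (renameEquiv ℂ e)) =
      (initialIdeal w I).map (renameEquiv ℂ e) := by
  have hI : ((I.map (renameEquiv ℂ e) :
      Ideal (MvPolynomial τ ℂ)) : Set (MvPolynomial τ ℂ)) = renameEquiv ℂ e '' I := by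
    ext x
    rw [SetLike.mem_coe, Ideal.mem_map_iff_of_surjective _ (renameEquiv ℂ e).surjective]
    rfl
  rw [initialIdeal, hI, initialIdeal, Ideal.map_span, Set.image_image, Set.image_image]
  congr 1
  exact Set.image_congr fun x _ => initialForm_rename e w x

theorem groebnerCone_map_rename (e : σ ≃ τ) (I J : Ideal (MvPolynomial σ ℂ)) :
    groebnerCone (I.map (renameEquiv ℂ e))
      (J.map (renameEquiv ℂ e)) =
      LinearEquiv.funCongrLeft ℝ ℝ e.symm '' groebnerCone I J := by
  have hinj : Function.Injective
      (Ideal.map (renameEquiv ℂ e)) := by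
    refine Function.LeftInverse.injective
      (g := Ideal.comap (renameEquiv ℂ e)) fun K => ?_
    exact Ideal.comap_map_of_bijective _ (renameEquiv ℂ e).bijective
  ext w
  constructor
  · intro h
    refine ⟨w ∘ e, hinj ?_, ?_⟩
    · rw [← initialIdeal_map_rename, ← h]
      congr 1
      ext; simp
    · ext; simp [LinearEquiv.funCongrLeft_apply, LinearMap.funLeft_apply]
  · rintro ⟨w, h, rfl⟩
    change initialIdeal (w ∘ e.symm) _ = _
    rw [initialIdeal_map_rename, h]

end InitialForm

/-! ### Chain monomials and their weights. -/

section Hibi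

variable {L : Type*} [DistribLattice L]

theorem mem_monomialIdeal_iff {f : MvPolynomial L ℂ} :
    f ∈ monomialIdeal L ↔ ∀ d ∈ f.support, ¬ IsChain (· ≤ ·) (d.support : Set L) := by
  classical
  have h : monomialIdeal L = Ideal.span ((fun s => monomial s (1 : ℂ)) ''
      {s | ∃ a b : L, ¬ a ≤ b ∧ ¬ b ≤ a ∧ s = Finsupp.single a 1 + Finsupp.single b 1}) := by
    rw [monomialIdeal]
    congr 1
    ext f
    constructor
    · rintro ⟨a, b, h1, h2, rfl⟩
      exact ⟨_, ⟨a, b, h1, h2, rfl⟩, by simp [X, monomial_mul]⟩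
    · rintro ⟨_, ⟨a, b, h1, h2, rfl⟩, rfl⟩
      exact ⟨a, b, h1, h2, by simp [X, monomial_mul]⟩
  rw [h, mem_ideal_span_monomial_image]
  refine forall₂_congr fun d _ => ?_
  constructor
  · rintro ⟨_, ⟨a, b, h1, h2, rfl⟩, hle⟩ hch
    have ha : a ∈ d.support := by
      have := hle a
      simp only [Finsupp.add_apply, Finsupp.single_eq_same] at this
      simp only [Finsupp.mem_support_iff]; omega
    have hb : b ∈ d.support := by
      have := hle b
      simp only [Finsupp.add_apply, Finsupp.single_eq_same] at this
      simp only [Finsupp.mem_support_iff]; omega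
    exact (hch.total ha hb).elim h1 h2
  · intro hch
    simp only [IsChain, Set.Pairwise, not_forall, not_or] at hch
    obtain ⟨a, ha, b, hb, hab, h1, h2⟩ := hch
    refine ⟨_, ⟨a, b, h1, h2, rfl⟩, fun x => ?_⟩
    simp only [Finset.mem_coe, Finsupp.mem_support_iff] at ha hb
    simp only [Finsupp.add_apply, Finsupp.single_apply]
    split_ifs with h3 h4 h4
    · exact absurd (h3.trans h4.symm) hab
    all_goals subst_vars; omega

/-- The point `v_a` together with the degree `1`. -/
noncomputable def homogenizedPoint (a : L) : (JoinIrr L → ℝ) × ℕ := (latticePoint a, 1)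

theorem weight_homogenizedPoint_snd (d : L →₀ ℕ) :
    (Finsupp.weight homogenizedPoint d).2 = d.degree := by
  simp [Finsupp.weight_apply, Finsupp.sum, homogenizedPoint, Prod.snd_sum, Finsupp.degree_apply]

/-- Under an affine weight, monomials with the same toric image have the same weight. -/
theorem weight_affine (y : (JoinIrr L → ℝ) →ₗ[ℝ] ℝ) (k : ℝ) (d : L →₀ ℕ) :
    Finsupp.weight (fun a => k + y (latticePoint a)) d =
      k * (Finsupp.weight homogenizedPoint d).2 + y (Finsupp.weight homogenizedPoint d).1 := by
  simp only [Finsupp.weight_apply, Finsupp.sum, homogenizedPoint, Prod.snd_sum, Prod.fst_sum,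
    Prod.smul_fst, Prod.smul_snd, map_sum, map_nsmul, smul_add, Finset.sum_add_distrib]
  simp [Finset.mul_sum, mul_comm]

variable [Finite L]

/-- The affine weight equal to the indicator of `a` on `M` reads off the exponent of `a` from the
toric image. -/
theorem eq_of_weight_homogenizedPoint_eq {M : Set L} (hM : IsChain (· ≤ ·) M) {d e : L →₀ ℕ}
    (hd : (d.support : Set L) ⊆ M) (he : (e.support : Set L) ⊆ M)
    (h : Finsupp.weight homogenizedPoint d = Finsupp.weight homogenizedPoint e) : d = e := by
  classical
  ext a
  obtain ⟨y, k, hyk⟩ := exists_linear_eqOn_chain hM (Pi.single a 1)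
  have key : ∀ d : L →₀ ℕ, (d.support : Set L) ⊆ M →
      Finsupp.weight (fun b => k + y (latticePoint b)) d = d a := fun d hd => by
    rw [Finsupp.weight_apply, Finsupp.sum,
      Finset.sum_congr rfl fun b hb => by rw [← hyk b (hd hb)]]
    by_cases ha : d a = 0
    · simp [Pi.single_apply, ha]
    · simp [Pi.single_apply, ha]
  have := key d hd
  rw [weight_affine, h, ← weight_affine, key e he] at this
  exact_mod_cast this.symm

/-- Replace `w` by the affine function tight on a maximal chain containing the support of `d`. This
keeps the weight of `d`, equalizes the two monomials, and strictly raises the weight of `e`, whose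
support must leave the chain. -/
theorem weight_lt_of_isChain {w : L → ℝ} (hw : StrictSupermodular w) {d e : L →₀ ℕ}
    (hd : IsChain (· ≤ ·) (d.support : Set L))
    (h : Finsupp.weight homogenizedPoint d = Finsupp.weight homogenizedPoint e) (hne : d ≠ e) :
    Finsupp.weight w e < Finsupp.weight w d := by
  obtain ⟨M, hM, hdM⟩ := hd.exists_maxChain
  obtain ⟨y, k, heq, hlt⟩ := exists_linear_tight hw hM
  have h1 : Finsupp.weight w d = Finsupp.weight (fun a => k + y (latticePoint a)) d := by
    rw [Finsupp.weight_apply, Finsupp.weight_apply]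
    exact Finset.sum_congr rfl fun a ha => by simp only [heq a (hdM ha)]
  rw [h1, weight_affine, h, ← weight_affine, Finsupp.weight_apply, Finsupp.weight_apply]
  have hnot : ¬ (e.support : Set L) ⊆ M := fun he =>
    hne (eq_of_weight_homogenizedPoint_eq hM.1 hdM he h)
  obtain ⟨a, ha, haM⟩ := Set.not_subset.1 hnot
  refine Finset.sum_lt_sum (fun b _ => ?_) ⟨a, ha, ?_⟩
  · refine nsmul_le_nsmul_right ?_ _
    by_cases hb : b ∈ M
    · exact (heq b hb).le
    · exact (hlt b hb).le
  · exact nsmul_lt_nsmul_right (Finsupp.mem_support_iff.1 ha) (hlt a haM)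

end Hibi

end HibiSecondary

namespace HibiSecondary

open MvPolynomial

/-! ### Straightening, the toric ideal and the Gröbner cone. -/

section Straightening

variable {L : Type*} [DistribLattice L]

theorem exponentHom_X_mul_X (a b : L) :
    exponentHom homogenizedPoint (X a * X b) =
      AddMonoidAlgebra.single (homogenizedPoint a + homogenizedPoint b) 1 := by
  simp [exponentHom, AddMonoidAlgebra.single_mul_single]

theorem hibiIdeal_le_ker : hibiIdeal L ≤ RingHom.ker (exponentHom (homogenizedPoint (L := L))) := by
  rw [hibiIdeal, Ideal.span_le]
  rintro _ ⟨a, b, rfl⟩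
  have h : homogenizedPoint a + homogenizedPoint b =
      homogenizedPoint (a ⊔ b) + homogenizedPoint (a ⊓ b) :=
    Prod.ext (latticePoint_sup_add_inf a b).symm rfl
  rw [SetLike.mem_coe, RingHom.mem_ker, map_sub, exponentHom_X_mul_X, exponentHom_X_mul_X, h,
    sub_self]

theorem weight_eq_of_sub_mem_hibiIdeal {d e : L →₀ ℕ}
    (h : monomial d (1 : ℂ) - monomial e 1 ∈ hibiIdeal L) :
    Finsupp.weight homogenizedPoint d = Finsupp.weight homogenizedPoint e := by
  have h1 := hibiIdeal_le_ker h
  rw [RingHom.mem_ker, map_sub, exponentHom_monomial, exponentHom_monomial, sub_eq_zero] at h1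
  exact ((AddMonoidAlgebra.single_left_inj one_ne_zero).1 h1)

theorem exists_sub_mem_hibiIdeal_weight_lt {w : L → ℝ} (hw : StrictSupermodular w) {d : L →₀ ℕ}
    (hd : ¬ IsChain (· ≤ ·) (d.support : Set L)) :
    ∃ e : L →₀ ℕ, monomial d (1 : ℂ) - monomial e 1 ∈ hibiIdeal L ∧
      Finsupp.weight w d < Finsupp.weight w e := by
  classical
  simp only [IsChain, Set.Pairwise, not_forall, not_or] at hd
  obtain ⟨a, ha, b, hb, hab, h1, h2⟩ := hd
  have hle : Finsupp.single a 1 + Finsupp.single b 1 ≤ d := by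
    intro x
    simp only [Finset.mem_coe, Finsupp.mem_support_iff] at ha hb
    simp only [Finsupp.add_apply, Finsupp.single_apply]
    split_ifs with h3 h4 h4
    · exact absurd (h3.trans h4.symm) hab
    all_goals subst_vars; omega
  obtain ⟨r, rfl⟩ := exists_add_of_le hle
  refine ⟨Finsupp.single (a ⊔ b) 1 + Finsupp.single (a ⊓ b) 1 + r, ?_, ?_⟩
  · have h : monomial (Finsupp.single a 1 + Finsupp.single b 1 + r) (1 : ℂ) -
        monomial (Finsupp.single (a ⊔ b) 1 + Finsupp.single (a ⊓ b) 1 + r) 1 =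
        monomial r 1 * (X a * X b - X (a ⊔ b) * X (a ⊓ b)) := by
      simp only [X, monomial_mul, mul_sub, mul_one, add_comm r]
    rw [h]
    exact Ideal.mul_mem_left _ _ (Ideal.subset_span ⟨a, b, rfl⟩)
  · simp only [map_add, Finsupp.weight_single, one_smul]
    linarith [hw a b h1 h2]

variable [Finite L]

/-- Straightening terminates: each replacement of an incomparable pair by its join and meet raises a
strictly supermodular weight. -/
theorem exists_isChain_sub_mem_hibiIdeal (d : L →₀ ℕ) :
    ∃ e : L →₀ ℕ, IsChain (· ≤ ·) (e.support : Set L) ∧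
      monomial d (1 : ℂ) - monomial e 1 ∈ hibiIdeal L := by
  obtain ⟨w, hw⟩ := exists_strictSupermodular (L := L)
  -- Hibi relations are homogeneous, so the class of `d` stays in one degree.
  have hfin : {e : L →₀ ℕ | monomial d (1 : ℂ) - monomial e 1 ∈ hibiIdeal L}.Finite := by
    refine (Finsupp.finite_of_degree_le d.degree).subset fun e he => ?_
    rw [Set.mem_ofPred_eq, ← weight_homogenizedPoint_snd, ← weight_homogenizedPoint_snd,
      weight_eq_of_sub_mem_hibiIdeal he]
  obtain ⟨e, he, hmax⟩ := Set.exists_max_image _ (Finsupp.weight w) hfin ⟨d, by simp⟩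
  refine ⟨e, ?_, he⟩
  by_contra hc
  obtain ⟨e', he', hlt⟩ := exists_sub_mem_hibiIdeal_weight_lt hw hc
  refine (hmax e' ?_).not_gt hlt
  have := add_mem (Set.mem_ofPred_eq ▸ he) he'
  rwa [sub_add_sub_cancel] at this

theorem hibiIdeal_eq_ker :
    hibiIdeal L = RingHom.ker (exponentHom (homogenizedPoint (L := L))) := by
  refine le_antisymm hibiIdeal_le_ker (ker_exponentHom_le fun d e hde => ?_)
  obtain ⟨d', hd', hdd'⟩ := exists_isChain_sub_mem_hibiIdeal d
  obtain ⟨e', he', hee'⟩ := exists_isChain_sub_mem_hibiIdeal e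
  have hw : Finsupp.weight homogenizedPoint d' = Finsupp.weight homogenizedPoint e' := by
    rw [← weight_eq_of_sub_mem_hibiIdeal hdd', hde, weight_eq_of_sub_mem_hibiIdeal hee']
  have h : d' = e' := by
    -- The two normal forms may lie on different chains, so they are compared by weight: if
    -- distinct, each would outweigh the other.
    by_contra hne
    obtain ⟨w, hw'⟩ := exists_strictSupermodular (L := L)
    exact lt_asymm (weight_lt_of_isChain hw' hd' hw hne)
      (weight_lt_of_isChain hw' he' hw.symm (Ne.symm hne))
  subst h
  have := sub_mem hdd' hee'
  rwa [sub_sub_sub_cancel_right] at this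

theorem initialIdeal_hibiIdeal {w : L → ℝ} (hw : StrictSupermodular w) :
    initialIdeal w (hibiIdeal L) = monomialIdeal L := by
  classical
  refine le_antisymm ?_ ?_
  · rw [initialIdeal, Ideal.span_le]
    rintro _ ⟨f, hf, rfl⟩
    rw [SetLike.mem_coe, mem_monomialIdeal_iff]
    intro s hs hch
    rw [mem_support_initialForm] at hs
    obtain ⟨d, hd, hds, hwt⟩ :=
      exists_ne_mem_support_of_exponentHom_eq_zero (hibiIdeal_le_ker hf) hs.1
    exact (hs.2 d hd).not_gt (weight_lt_of_isChain hw hch hwt.symm hds.symm)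
  · rw [monomialIdeal, Ideal.span_le]
    rintro _ ⟨a, b, h1, h2, rfl⟩
    refine Ideal.subset_span ⟨_, Ideal.subset_span ⟨a, b, rfl⟩, ?_⟩
    have hlt := hw a b h1 h2
    set d : L →₀ ℕ := Finsupp.single a 1 + Finsupp.single b 1 with hd
    set e : L →₀ ℕ := Finsupp.single (a ⊔ b) 1 + Finsupp.single (a ⊓ b) 1 with he
    have hX : (X a * X b : MvPolynomial L ℂ) = monomial d 1 := by simp [X, monomial_mul, hd]
    have hX' : (X (a ⊔ b) * X (a ⊓ b) : MvPolynomial L ℂ) = monomial e 1 := by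
      simp [X, monomial_mul, he]
    have hde : Finsupp.weight w d < Finsupp.weight w e := by
      simpa [hd, he, Finsupp.weight_single] using hlt
    have hne : e ≠ d := fun h => hde.ne (by rw [h])
    rw [hX, hX']
    have hsupp : ∀ x, x ∈ (monomial d (1 : ℂ) - monomial e 1).support ↔ x = d ∨ x = e := by
      intro x
      rw [mem_support_iff, coeff_sub, coeff_monomial, coeff_monomial]
      by_cases hxd : d = x
      · subst hxd; simp [hne]
      · by_cases hxe : e = x
        · subst hxe; simp [hne.symm]
        · simp [hxd, hxe, Ne.symm hxd, Ne.symm hxe]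
    ext x
    rw [coeff_initialForm]
    simp only [hsupp, forall_eq_or_imp, forall_eq, coeff_sub, coeff_monomial]
    by_cases hxd : d = x
    · subst hxd; simp [hde.le, hne]
    · by_cases hxe : e = x
      · subst hxe; simp [hde, hxd]
      · simp [hxd, hxe]

/-- If the inequality fails at `a`, `b`, then `X (a ⊔ b) * X (a ⊓ b)` survives in the initial form
of the Hibi relation. It is a chain monomial, so that form is not in `monomialIdeal L`. -/
theorem groebnerCone_hibiIdeal :
    groebnerCone (hibiIdeal L) (monomialIdeal L) = {w | StrictSupermodular w} := by
  classical
  ext w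
  refine ⟨fun h a b h1 h2 => ?_, initialIdeal_hibiIdeal⟩
  by_contra hle
  have hle' := not_lt.1 hle
  set d : L →₀ ℕ := Finsupp.single a 1 + Finsupp.single b 1 with hd
  set e : L →₀ ℕ := Finsupp.single (a ⊔ b) 1 + Finsupp.single (a ⊓ b) 1 with he
  have hX : (X a * X b : MvPolynomial L ℂ) = monomial d 1 := by simp [X, monomial_mul, hd]
  have hX' : (X (a ⊔ b) * X (a ⊓ b) : MvPolynomial L ℂ) = monomial e 1 := by
    simp [X, monomial_mul, he]
  have hde : Finsupp.weight w e ≤ Finsupp.weight w d := by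
    simpa [hd, he, Finsupp.weight_single] using hle'
  have hch : IsChain (· ≤ ·) (e.support : Set L) := by
    have hsub : (e.support : Set L) ⊆ {a ⊔ b, a ⊓ b} := by
      intro x hx
      by_contra hc
      simp only [Set.mem_insert_iff, Set.mem_singleton_iff, not_or] at hc
      have : e x = 0 := by simp [he, Ne.symm hc.1, Ne.symm hc.2]
      exact Finsupp.mem_support_iff.1 hx this
    exact (IsChain.pair (inf_le_left.trans le_sup_left : a ⊓ b ≤ a ⊔ b)).mono
      (by rwa [Set.pair_comm] at hsub)
  have hne : e ≠ d := by
    intro h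
    have ha : a ∈ (e.support : Set L) := by simp [h, hd]
    have hb : b ∈ (e.support : Set L) := by simp [h, hd]
    exact (hch.total ha hb).elim h1 h2
  have hmem : initialForm w (X a * X b - X (a ⊔ b) * X (a ⊓ b)) ∈ monomialIdeal L := by
    have h' : initialIdeal w (hibiIdeal L) = monomialIdeal L := h
    rw [← h']
    exact Ideal.subset_span ⟨_, Ideal.subset_span ⟨a, b, rfl⟩, rfl⟩
  rw [hX, hX', mem_monomialIdeal_iff] at hmem
  refine hmem e (mem_support_initialForm.2 ⟨?_, fun x hx => ?_⟩) hch
  · simp [coeff_monomial, hne.symm]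
  · by_cases hxe : x = e
    · rw [hxe]
    · have hxd : x = d := by
        by_contra hxd
        simp [coeff_monomial, Ne.symm hxe, Ne.symm hxd] at hx
      rwa [hxd]

theorem toricIdeal_eq_map_hibiIdeal [Nonempty L] :
    toricIdeal (vertices (orderPolytope (JoinIrr L))) =
      (hibiIdeal L).map (renameEquiv ℂ (vertexEquiv L)) := by
  have h : (exponentHom (homogenizedPoint (L := L)) : MvPolynomial L ℂ →+* _) =
      (aeval (fun v : vertices (orderPolytope (JoinIrr L)) =>
        AddMonoidAlgebra.single ((v : JoinIrr L → ℝ), (1 : ℕ)) (1 : ℂ)) :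
        MvPolynomial _ ℂ →ₐ[ℂ] AddMonoidAlgebra ℂ ((JoinIrr L → ℝ) × ℕ)).toRingHom.comp
        (renameEquiv ℂ (vertexEquiv L)).toRingEquiv.toRingHom := by
    refine MvPolynomial.ringHom_ext (fun r => ?_) fun a => ?_
    · simp [exponentHom]
    · simp [exponentHom, homogenizedPoint, vertexEquiv]
  ext f
  obtain ⟨g, rfl⟩ := (renameEquiv ℂ (vertexEquiv L)).surjective f
  have hg := congrArg (fun φ : MvPolynomial L ℂ →+* _ => φ g) h
  rw [hibiIdeal_eq_ker, toricIdeal, RingHom.mem_ker,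
    Ideal.mem_map_iff_of_surjective _ (renameEquiv ℂ (vertexEquiv L)).surjective]
  constructor
  · intro h0
    exact ⟨g, hg.trans h0, rfl⟩
  · rintro ⟨g', hg', hgg⟩
    rw [(renameEquiv ℂ (vertexEquiv L)).injective hgg] at hg'
    exact hg.symm.trans hg'

theorem groebnerCone_toricIdeal [Nonempty L] :
    groebnerCone (toricIdeal (vertices (orderPolytope (JoinIrr L))))
      ((monomialIdeal L).map (renameEquiv ℂ (vertexEquiv L))) =
      psi L '' groebnerCone (hibiIdeal L) (monomialIdeal L) := by
  rw [toricIdeal_eq_map_hibiIdeal, groebnerCone_map_rename]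
  rfl

theorem isOpen_strictSupermodular : IsOpen {w : L → ℝ | StrictSupermodular w} := by
  simp only [StrictSupermodular, Set.ofPred_forall]
  refine isOpen_iInter_of_finite fun a => isOpen_iInter_of_finite fun b =>
    isOpen_iInter_of_finite fun _ => isOpen_iInter_of_finite fun _ => ?_
  exact isOpen_lt (by fun_prop) (by fun_prop)

end Straightening

/-! ### Open cones of a fan. -/

theorem isMaximalCone_of_isOpen {E : Type*} [TopologicalSpace E] {fan : Set (Set E)} {C : Set E}
    (hfan : ∀ C ∈ fan, ∀ D ∈ fan, (C ∩ D).Nonempty → C = D) (hC : C ∈ fan) (ho : IsOpen C)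
    (hne : C.Nonempty) : IsMaximalCone fan C := by
  refine ⟨hC, fun D hD hCD => hfan C hC D hD ?_⟩
  obtain ⟨x, hx⟩ := hne
  exact mem_closure_iff.1 (hCD (subset_closure hx)) C ho hx

theorem eq_of_mem_groebnerFan {σ : Type*} {I : Ideal (MvPolynomial σ ℂ)} :
    ∀ C ∈ groebnerFan I, ∀ D ∈ groebnerFan I, (C ∩ D).Nonempty → C = D := by
  rintro _ ⟨_, J, rfl⟩ _ ⟨_, K, rfl⟩ ⟨w, hJ, hK⟩
  rw [← (hJ : initialIdeal w I = J), ← (hK : initialIdeal w I = K)]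

theorem eq_of_mem_secondaryFan {ι : Type*} {Q : Set (ι → ℝ)} :
    ∀ C ∈ secondaryFan Q, ∀ D ∈ secondaryFan Q, (C ∩ D).Nonempty → C = D := by
  rintro _ ⟨Θ, _, rfl⟩ _ ⟨Θ', _, rfl⟩ ⟨c, h, h'⟩
  rw [← (h : regularSubdivision Q c = Θ), ← (h' : regularSubdivision Q c = Θ')]

end HibiSecondary

namespace HibiSecondary

/-! ### Bounded facets of the hypograph as affine majorants. -/

section Hypograph

variable {ι : Type*} {Q : Set (ι → ℝ)} {c : vertices Q → ℝ} {y : (ι → ℝ) →ₗ[ℝ] ℝ} {k : ℝ}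

/-- The vertices at which `c` agrees with the affine function `x ↦ k + y x`. -/
def contactSet (c : vertices Q → ℝ) (y : (ι → ℝ) →ₗ[ℝ] ℝ) (k : ℝ) : Set (ι → ℝ) :=
  Subtype.val '' {v : vertices Q | c v = k + y v}

/-- The graph embedding of the affine function `x ↦ k + y x`. -/
def graphMap (y : (ι → ℝ) →ₗ[ℝ] ℝ) (k : ℝ) : (ι → ℝ) →ᵃ[ℝ] (ι → ℝ) × ℝ :=
  (AffineMap.id ℝ (ι → ℝ)).prod (AffineMap.const ℝ (ι → ℝ) k + y.toAffineMap)

@[simp]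
theorem graphMap_apply (x : ι → ℝ) : graphMap y k x = (x, k + y x) := rfl

theorem mem_hypograph (v : vertices Q) {t : ℝ} (ht : t ≤ c v) :
    ((v : ι → ℝ), t) ∈ hypograph Q c :=
  subset_convexHull ℝ _ ⟨v, rfl, ht⟩

theorem sub_mem_hypograph {p : (ι → ℝ) × ℝ} (hp : p ∈ hypograph Q c) {t : ℝ} (ht : 0 ≤ t) :
    p - (0, t) ∈ hypograph Q c := by
  have hsub : hypograph Q c ⊆ (fun q => q - ((0 : ι → ℝ), t)) ⁻¹' hypograph Q c := by
    refine convexHull_min ?_ ?_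
    · rintro ⟨x, z⟩ ⟨v, rfl, hv⟩
      have h : z - t ≤ c v := (sub_le_self z ht).trans hv
      simpa using mem_hypograph v h
    · intro a ha b hb r s hr hs hrs
      have h := convex_convexHull ℝ _ ha hb hr hs hrs
      have e : r • (a - ((0 : ι → ℝ), t)) + s • (b - ((0 : ι → ℝ), t)) =
          r • a + s • b - (0, t) := by
        rw [smul_sub, smul_sub, sub_add_sub_comm, ← add_smul, hrs, one_smul]
      rw [Set.mem_preimage, ← e]
      exact h
  exact hsub hp

/-- The two conditions together define a convex set containing the rays: equality at a proper convex
combination forces equality at both ends. -/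
theorem mem_hypograph_le_and_mem_convexHull (hc : ∀ v : vertices Q, c v ≤ k + y v)
    {p : (ι → ℝ) × ℝ} (hp : p ∈ hypograph Q c) :
    p.2 ≤ k + y p.1 ∧ (p.2 = k + y p.1 → p.1 ∈ convexHull ℝ (contactSet c y k)) := by
  let S : Set ((ι → ℝ) × ℝ) :=
    {p | p.2 ≤ k + y p.1 ∧ (p.2 = k + y p.1 → p.1 ∈ convexHull ℝ (contactSet c y k))}
  have hsub : hypograph Q c ⊆ S := by
    refine convexHull_min ?_ (convex_iff_forall_pos.2 ?_)
    · rintro ⟨x, z⟩ ⟨v, rfl, hv⟩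
      refine ⟨hv.trans (hc v), fun h => subset_convexHull ℝ _ ⟨v, ?_, rfl⟩⟩
      exact le_antisymm (hc v) (h ▸ hv)
    · rintro p ⟨hp, hp'⟩ q ⟨hq, hq'⟩ a b ha hb hab
      have e : k + y (a • p + b • q).1 = a * (k + y p.1) + b * (k + y q.1) := by
        simp only [Prod.fst_add, Prod.smul_fst, map_add, map_smul, smul_eq_mul]
        linear_combination (-k) * hab
      have e' : (a • p + b • q).2 = a * p.2 + b * q.2 := rfl
      have h1 := mul_le_mul_of_nonneg_left hp ha.le
      have h2 := mul_le_mul_of_nonneg_left hq hb.le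
      refine ⟨by rw [e, e']; linarith, fun h => ?_⟩
      rw [e, e'] at h
      exact convex_convexHull ℝ _ (hp' (mul_left_cancel₀ ha.ne' (by linarith)))
        (hq' (mul_left_cancel₀ hb.ne' (by linarith))) ha.le hb.le hab
  exact hsub hp

theorem hypograph_contact_eq (hc : ∀ v : vertices Q, c v ≤ k + y v) :
    {p ∈ hypograph Q c | p.2 = k + y p.1} =
      graphMap y k '' convexHull ℝ (contactSet c y k) := by
  ext p
  constructor
  · rintro ⟨hp, h⟩
    exact ⟨p.1, (mem_hypograph_le_and_mem_convexHull hc hp).2 h, Prod.ext rfl h.symm⟩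
  · rintro ⟨x, hx, rfl⟩
    refine ⟨?_, rfl⟩
    have h : graphMap y k x ∈ graphMap y k '' convexHull ℝ (contactSet c y k) := ⟨x, hx, rfl⟩
    rw [AffineMap.image_convexHull] at h
    refine convexHull_mono ?_ h
    rintro _ ⟨_, ⟨v, hv, rfl⟩, rfl⟩
    exact ⟨v, rfl, hv.ge⟩

theorem fst_image_graphMap (s : Set (ι → ℝ)) : Prod.fst '' (graphMap y k '' s) = s := by
  rw [Set.image_image]
  simp

theorem vectorSpan_convexHull (s : Set (ι → ℝ)) :
    vectorSpan ℝ (convexHull ℝ s) = vectorSpan ℝ s := by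
  rw [← direction_affineSpan, affineSpan_convexHull, direction_affineSpan]

theorem finrank_vectorSpan_graphMap (s : Set (ι → ℝ)) :
    Module.finrank ℝ (vectorSpan ℝ (graphMap y k '' s)) = Module.finrank ℝ (vectorSpan ℝ s) := by
  rw [← AffineMap.map_vectorSpan]
  refine (Submodule.equivMapOfInjective _ (fun u v h => ?_) _).finrank_eq.symm
  exact congrArg Prod.fst h

theorem vectorSpan_hypograph (hQ : vectorSpan ℝ (vertices Q) = ⊤) (hne : (vertices Q).Nonempty) :
    vectorSpan ℝ (hypograph Q c) = ⊤ := by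
  obtain ⟨v, hv⟩ := hne
  have h01 : ((0 : ι → ℝ), (1 : ℝ)) ∈ vectorSpan ℝ (hypograph Q c) := by
    have h := vsub_mem_vectorSpan ℝ (mem_hypograph (c := c) ⟨v, hv⟩ le_rfl)
      (mem_hypograph (c := c) ⟨v, hv⟩ (sub_le_self _ zero_le_one))
    simpa using h
  have hfst : (vectorSpan ℝ (hypograph Q c)).map (LinearMap.fst ℝ (ι → ℝ) ℝ) = ⊤ := by
    rw [eq_top_iff, ← hQ]
    have h := AffineMap.map_vectorSpan (LinearMap.fst ℝ (ι → ℝ) ℝ).toAffineMap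
      (s := hypograph Q c)
    rw [LinearMap.toAffineMap_linear] at h
    rw [h]
    refine vectorSpan_mono ℝ fun u hu => ?_
    exact ⟨_, mem_hypograph (c := c) ⟨u, hu⟩ le_rfl, rfl⟩
  rw [eq_top_iff]
  rintro ⟨x, z⟩ -
  obtain ⟨⟨x', z'⟩, h, rfl⟩ : x ∈ (vectorSpan ℝ (hypograph Q c)).map (LinearMap.fst ℝ _ ℝ) :=
    hfst ▸ Submodule.mem_top
  have := add_mem h (Submodule.smul_mem _ (z - z') h01)
  simpa using this

/-- Bounded facets are exposed by non-vertical hyperplanes, that is, by graphs of affine majorants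
of `c` whose contact set spans all directions. -/
theorem mem_regularSubdivision_iff [Finite ι] (hQ : vectorSpan ℝ (vertices Q) = ⊤)
    (hfin : (vertices Q).Finite) {D : Set (ι → ℝ)} :
    D ∈ regularSubdivision Q c ↔ ∃ (y : (ι → ℝ) →ₗ[ℝ] ℝ) (k : ℝ),
      (∀ v : vertices Q, c v ≤ k + y v) ∧ (contactSet c y k).Nonempty ∧
        vectorSpan ℝ (contactSet c y k) = ⊤ ∧ D = convexHull ℝ (contactSet c y k) := by
  have _ : Fintype ι := Fintype.ofFinite ι
  constructor
  · rintro ⟨F, ⟨hne, hexp, hdim⟩, hbd, rfl⟩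
    obtain ⟨l, hl⟩ := hexp hne
    obtain ⟨p₀, hp₀⟩ := hne
    have hp₀T : p₀ ∈ hypograph Q c := by rw [hl] at hp₀; exact hp₀.1
    have hmax : ∀ q ∈ hypograph Q c, l q ≤ l p₀ := by rw [hl] at hp₀; exact hp₀.2
    have hF : ∀ p, p ∈ F ↔ p ∈ hypograph Q c ∧ l p = l p₀ := fun p => by
      rw [hl]
      exact ⟨fun h => ⟨h.1, le_antisymm (hmax p h.1) (h.2 p₀ hp₀T)⟩,
        fun h => ⟨h.1, fun q hq => h.2 ▸ hmax q hq⟩⟩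
    set s := l ((0 : ι → ℝ), (1 : ℝ)) with hs
    have hl_apply : ∀ p, l p = l (p.1, 0) + p.2 * s := fun p => by
      have : p = (p.1, 0) + p.2 • ((0 : ι → ℝ), (1 : ℝ)) := by ext <;> simp
      conv_lhs => rw [this]
      rw [map_add, map_smul, smul_eq_mul]
    have hl_sub : ∀ (p) (t : ℝ), l (p - (0, t)) = l p - t * s := fun p t => by
      rw [hl_apply, hl_apply p]
      simp only [Prod.fst_sub, Prod.snd_sub, sub_zero]
      ring
    have hs0 : 0 ≤ s := by
      have := hmax _ (sub_mem_hypograph hp₀T zero_le_one)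
      rw [hl_sub] at this
      linarith
    -- If the vertical coefficient vanished, the face would contain a downward ray and be unbounded.
    have hspos : 0 < s := by
      refine lt_of_le_of_ne hs0 fun h0 => ?_
      obtain ⟨B, hB⟩ := isBounded_iff_forall_norm_le.1 hbd
      have ht : 0 ≤ |p₀.2| + |B| + 1 := by positivity
      have hmem : p₀ - (0, |p₀.2| + |B| + 1) ∈ F :=
        (hF _).2 ⟨sub_mem_hypograph hp₀T ht, by rw [hl_sub, ← h0, mul_zero, sub_zero]⟩
      have h1 := (norm_snd_le _).trans (hB _ hmem)
      rw [Prod.snd_sub, Real.norm_eq_abs] at h1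
      have h2 := neg_abs_le (p₀.2 - (|p₀.2| + |B| + 1))
      have h3 := le_abs_self p₀.2
      have h4 := le_abs_self B
      simp only at h1 h2
      linarith
    -- Solves the hyperplane equation `l p = l p₀` for the height coordinate.
    let y : (ι → ℝ) →ₗ[ℝ] ℝ := -(s⁻¹ • (l.toLinearMap ∘ₗ LinearMap.inl ℝ (ι → ℝ) ℝ))
    have hy : ∀ x, y x = -(s⁻¹ * l (x, 0)) := fun x => rfl
    have hc : ∀ v : vertices Q, c v ≤ s⁻¹ * l p₀ + y v := fun v => by
      have h := hmax _ (mem_hypograph v le_rfl)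
      rw [hl_apply] at h
      rw [hy, ← sub_eq_add_neg, ← mul_sub, ← div_eq_inv_mul, le_div_iff₀ hspos]
      simp only at h
      linarith
    have hFeq : F = graphMap y (s⁻¹ * l p₀) '' convexHull ℝ (contactSet c y (s⁻¹ * l p₀)) := by
      rw [← hypograph_contact_eq hc]
      ext p
      rw [hF]
      refine and_congr_right fun _ => ?_
      rw [hy, ← sub_eq_add_neg, ← mul_sub, ← div_eq_inv_mul, eq_div_iff hspos.ne', hl_apply p]
      constructor <;> intro h <;> linarith
    refine ⟨y, s⁻¹ * l p₀, hc, ?_, ?_, ?_⟩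
    · rw [hFeq] at hp₀
      obtain ⟨x, hx, -⟩ := hp₀
      exact convexHull_nonempty_iff.1 ⟨x, hx⟩
    · have hneQ : (vertices Q).Nonempty := by
        rw [hFeq] at hp₀
        obtain ⟨x, hx, -⟩ := hp₀
        obtain ⟨_, v, -, rfl⟩ := convexHull_nonempty_iff.1 ⟨x, hx⟩
        exact ⟨v, v.2⟩
      rw [vectorSpan_hypograph hQ hneQ, hFeq, finrank_vectorSpan_graphMap, vectorSpan_convexHull,
        finrank_top, Module.finrank_prod, Module.finrank_self] at hdim
      exact Submodule.eq_top_of_finrank_eq (Nat.succ_injective hdim)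
    · rw [hFeq, fst_image_graphMap]
  · rintro ⟨y, k, hc, hne, hspan, rfl⟩
    have hneQ : (vertices Q).Nonempty := by
      obtain ⟨_, v, -, rfl⟩ := hne
      exact ⟨v, v.2⟩
    refine ⟨graphMap y k '' convexHull ℝ (contactSet c y k), ⟨?_, fun _ => ?_, ?_⟩, ?_, ?_⟩
    · exact (convexHull_nonempty_iff.2 hne).image _
    · refine ⟨ContinuousLinearMap.snd ℝ _ ℝ -
        (LinearMap.toContinuousLinearMap y).comp (ContinuousLinearMap.fst ℝ _ ℝ), ?_⟩
      rw [← hypograph_contact_eq hc]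
      ext p
      refine and_congr_right fun hp => ?_
      simp only [sub_apply, ContinuousLinearMap.coe_snd',
        ContinuousLinearMap.comp_apply, ContinuousLinearMap.coe_fst',
        LinearMap.coe_toContinuousLinearMap']
      constructor
      · intro h q hq
        have := (mem_hypograph_le_and_mem_convexHull hc hq).1
        linarith
      · intro h
        obtain ⟨_, v, hv, rfl⟩ := hne
        have h1 := h _ (mem_hypograph v le_rfl)
        have h2 : c v = k + y v := hv
        have h3 := (mem_hypograph_le_and_mem_convexHull hc hp).1
        simp only at h1
        linarith
    · rw [vectorSpan_hypograph hQ hneQ, finrank_vectorSpan_graphMap, vectorSpan_convexHull, hspan,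
        finrank_top, finrank_top, Module.finrank_prod, Module.finrank_self]
    · have hA : (contactSet c y k).Finite :=
        hfin.subset (by rintro _ ⟨v, -, rfl⟩; exact v.2)
      exact ((hA.isCompact_convexHull ℝ).image
        (graphMap y k).continuous_of_finiteDimensional).isBounded
    · rw [fst_image_graphMap]

end Hypograph

/-! ### The chain triangulation of the order polytope. -/

section OrderPolytope

variable {L : Type*} [DistribLattice L] [Finite L] [Nonempty L]

theorem psi_apply_latticePoint (w : L → ℝ) (a : L) :
    psi L w ⟨latticePoint a, latticePoint_mem a⟩ = w a :=
  congrArg w ((vertexEquiv L).symm_apply_apply a)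

theorem forall_vertices_iff {p : vertices (orderPolytope (JoinIrr L)) → Prop} :
    (∀ v, p v) ↔ ∀ a : L, p ⟨latticePoint a, latticePoint_mem a⟩ :=
  (vertexEquiv L).surjective.forall

theorem contactSet_psi (w : L → ℝ) (y : (JoinIrr L → ℝ) →ₗ[ℝ] ℝ) (k : ℝ) :
    contactSet (psi L w) y k = latticePoint '' {a | w a = k + y (latticePoint a)} := by
  ext x
  constructor
  · rintro ⟨v, hv, rfl⟩
    obtain ⟨a, rfl⟩ := (vertexEquiv L).surjective v
    exact ⟨a, (psi_apply_latticePoint w a).symm.trans hv, rfl⟩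
  · rintro ⟨a, ha, rfl⟩
    exact ⟨⟨_, latticePoint_mem a⟩, (psi_apply_latticePoint w a).trans ha, rfl⟩

theorem latticePoint_injective : Function.Injective (latticePoint (L := L)) := fun _ _ h =>
  latticePoint_bijective.injective (Subtype.ext h)

theorem vectorSpan_vertices_orderPolytope :
    vectorSpan ℝ (vertices (orderPolytope (JoinIrr L))) = ⊤ := by
  obtain ⟨M, hM, -⟩ := (IsChain.empty (α := L) (r := (· ≤ ·))).exists_maxChain
  rw [eq_top_iff, ← vectorSpan_latticePoint_eq_top hM]
  refine vectorSpan_mono ℝ ?_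
  rintro _ ⟨a, -, rfl⟩
  exact latticePoint_mem a

theorem mem_regularSubdivision_psi_iff {w : L → ℝ} {D : Set (JoinIrr L → ℝ)} :
    D ∈ regularSubdivision (orderPolytope (JoinIrr L)) (psi L w) ↔
      ∃ (y : (JoinIrr L → ℝ) →ₗ[ℝ] ℝ) (k : ℝ) (A : Set L),
        A = {a | w a = k + y (latticePoint a)} ∧ (∀ a, w a ≤ k + y (latticePoint a)) ∧
        A.Nonempty ∧ vectorSpan ℝ (latticePoint '' A) = ⊤ ∧
        D = convexHull ℝ (latticePoint '' A) := by
  rw [mem_regularSubdivision_iff vectorSpan_vertices_orderPolytope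
    (Finite.of_equiv L (vertexEquiv L))]
  refine exists₂_congr fun y k => ?_
  simp only [forall_vertices_iff, psi_apply_latticePoint, contactSet_psi, Set.image_nonempty,
    exists_eq_left]

variable (L) in
/-- The simplices spanned by the maximal chains of the lattice. -/
def chainTriangulation : Set (Set (JoinIrr L → ℝ)) :=
  {D | ∃ M : Set L, IsMaxChain (· ≤ ·) M ∧ D = convexHull ℝ (latticePoint '' M)}

/-- A contact set has no incomparable pair, since supermodularity would break the majorant at the
join or the meet. Being full-dimensional, it must be an entire maximal chain. The converse is
`exists_linear_tight`. -/
theorem regularSubdivision_psi {w : L → ℝ} (hw : StrictSupermodular w) :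
    regularSubdivision (orderPolytope (JoinIrr L)) (psi L w) = chainTriangulation L := by
  ext D
  rw [mem_regularSubdivision_psi_iff]
  constructor
  · rintro ⟨y, k, A, hA, hle, hne, hspan, rfl⟩
    have hAmem : ∀ a, a ∈ A ↔ w a = k + y (latticePoint a) := fun a => by rw [hA]; rfl
    have hch : IsChain (· ≤ ·) A := by
      intro a ha b hb _
      by_contra! hc
      have h1 := hw a b hc.1 hc.2
      have h2 := map_latticePoint_sup_add_inf y a b
      linarith [(hAmem a).1 ha, (hAmem b).1 hb, hle (a ⊔ b), hle (a ⊓ b)]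
    obtain ⟨M, hM, hAM⟩ := hch.exists_maxChain
    suffices hMA : M ⊆ A by
      obtain rfl := hAM.antisymm hMA
      exact ⟨A, hM, rfl⟩
    classical
    intro m hm
    by_contra hmA
    -- An affine function that is `1` at the missing `m` and `0` on `A` contradicts full dimension.
    obtain ⟨z, j, hz⟩ := exists_linear_eqOn_chain hM.1 (Pi.single m 1)
    have hzA : ∀ a ∈ A, j + z (latticePoint a) = 0 := fun a ha => by
      rw [← hz a (hAM ha), Pi.single_eq_of_ne (ne_of_mem_of_not_mem ha hmA)]
    have hz0 : vectorSpan ℝ (latticePoint '' A) ≤ LinearMap.ker z := by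
      rw [vectorSpan, Submodule.span_le]
      rintro _ ⟨_, ⟨a, ha, rfl⟩, _, ⟨b, hb, rfl⟩, rfl⟩
      simp only [vsub_eq_sub, SetLike.mem_coe, LinearMap.mem_ker, map_sub]
      linarith [hzA a ha, hzA b hb]
    rw [hspan, top_le_iff, LinearMap.ker_eq_top] at hz0
    obtain ⟨a, ha⟩ := hne
    have h1 := hzA a ha
    have h2 := hz m hm
    simp [hz0] at h1 h2
    linarith
  · rintro ⟨M, hM, rfl⟩
    obtain ⟨y, k, heq, hlt⟩ := exists_linear_tight hw hM
    refine ⟨y, k, M, ?_, fun a => ?_, ?_, vectorSpan_latticePoint_eq_top hM, rfl⟩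
    · ext a
      refine ⟨heq a, fun h => ?_⟩
      by_contra ha
      exact (hlt a ha).ne h
    · by_cases ha : a ∈ M
      · exact (heq a ha).le
      · exact (hlt a ha).le
    · exact hM.nonempty_iff.1 inferInstance

theorem convex_orderPolytope (P : Type*) [PartialOrder P] : Convex ℝ (orderPolytope P) := by
  intro x hx y hy a b ha hb hab
  refine ⟨fun p => ⟨?_, ?_⟩, fun p q hqp => ?_⟩
  · exact add_nonneg (mul_nonneg ha (hx.1 p).1) (mul_nonneg hb (hy.1 p).1)
  · calc a * x p + b * y p ≤ a * 1 + b * 1 :=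
        add_le_add (mul_le_mul_of_nonneg_left (hx.1 p).2 ha)
          (mul_le_mul_of_nonneg_left (hy.1 p).2 hb)
      _ = 1 := by rw [mul_one, mul_one, hab]
  · exact add_le_add (mul_le_mul_of_nonneg_left (hx.2 p q hqp) ha)
      (mul_le_mul_of_nonneg_left (hy.2 p q hqp) hb)

/-- Each `v_a` is extreme in the order polytope, so a cell determines the lattice elements that span
it. -/
theorem latticePoint_mem_convexHull_iff {a : L} {A : Set L} :
    latticePoint a ∈ convexHull ℝ (latticePoint '' A) ↔ a ∈ A := by
  refine ⟨fun h => ?_, fun h => subset_convexHull ℝ _ ⟨a, h, rfl⟩⟩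
  have hsub : convexHull ℝ (latticePoint '' A) ⊆ orderPolytope (JoinIrr L) := by
    refine convexHull_min ?_ (convex_orderPolytope _)
    rintro _ ⟨b, -, rfl⟩
    exact (latticePoint_mem b).1
  obtain ⟨b, hb, hab⟩ := extremePoints_convexHull_subset
    (inter_extremePoints_subset_extremePoints_of_subset hsub ⟨h, latticePoint_mem a⟩)
  exact latticePoint_injective hab ▸ hb

/-- The majorant of a maximal chain through `a ⊓ b` and `a ⊔ b` is tight at both, but not at both of
the incomparable `a` and `b`. Its modularity gives the strict inequality. -/
theorem strictSupermodular_of_regularSubdivision_psi {w : L → ℝ}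
    (h : regularSubdivision (orderPolytope (JoinIrr L)) (psi L w) = chainTriangulation L) :
    StrictSupermodular w := by
  intro a b hab hba
  obtain ⟨M, hM, hsub⟩ :=
    (IsChain.pair (inf_le_left.trans le_sup_left : a ⊓ b ≤ a ⊔ b)).exists_maxChain
  have hmem : convexHull ℝ (latticePoint '' M) ∈
      regularSubdivision (orderPolytope (JoinIrr L)) (psi L w) := h ▸ ⟨M, hM, rfl⟩
  obtain ⟨y, k, A, hA, hle, -, -, hMA⟩ := mem_regularSubdivision_psi_iff.1 hmem
  have hMA' : ∀ x, x ∈ M ↔ w x = k + y (latticePoint x) := fun x => by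
    rw [← latticePoint_mem_convexHull_iff (A := M), hMA, latticePoint_mem_convexHull_iff, hA]
    rfl
  have h1 := (hMA' _).1 (hsub (Set.mem_insert _ _))
  have h2 := (hMA' _).1 (hsub (Set.mem_insert_of_mem _ rfl))
  have h3 := map_latticePoint_sup_add_inf y a b
  have h4 : w a < k + y (latticePoint a) ∨ w b < k + y (latticePoint b) := by
    by_contra! hc
    have ha := (hMA' a).2 (le_antisymm (hle a) hc.1)
    have hb := (hMA' b).2 (le_antisymm (hle b) hc.2)
    exact (hM.1.total ha hb).elim hab hba
  rcases h4 with h4 | h4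
  · linarith [hle b]
  · linarith [hle a]

theorem secondaryCone_chainTriangulation :
    secondaryCone (orderPolytope (JoinIrr L)) (chainTriangulation L) =
      psi L '' {w | StrictSupermodular w} := by
  ext c
  constructor
  · intro h
    obtain ⟨w, rfl⟩ := (psi L).surjective c
    exact ⟨w, strictSupermodular_of_regularSubdivision_psi h, rfl⟩
  · rintro ⟨w, hw, rfl⟩
    exact regularSubdivision_psi hw

end OrderPolytope

end HibiSecondary

/-! ### Maximality in the three fans. -/

open HibiSecondary in
theorem corollary2p11 (L : Type*) [DistribLattice L] [Finite L] [Nonempty L] :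
    IsMaximalCone (secondaryFan (orderPolytope (JoinIrr L)))
      (psi L '' groebnerCone (hibiIdeal L) (monomialIdeal L)) ∧
    IsMaximalCone (groebnerFan (toricIdeal (vertices (orderPolytope (JoinIrr L)))))
      (psi L '' groebnerCone (hibiIdeal L) (monomialIdeal L)) ∧
    IsMaximalCone (groebnerFan (hibiIdeal L))
      (groebnerCone (hibiIdeal L) (monomialIdeal L)) := by
  obtain ⟨w, hw⟩ := exists_strictSupermodular (L := L)
  have hne : (groebnerCone (hibiIdeal L) (monomialIdeal L)).Nonempty :=
    ⟨w, initialIdeal_hibiIdeal hw⟩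
  have ho : IsOpen (groebnerCone (hibiIdeal L) (monomialIdeal L)) := by
    rw [groebnerCone_hibiIdeal]
    exact isOpen_strictSupermodular
  have ho' : IsOpen (psi L '' groebnerCone (hibiIdeal L) (monomialIdeal L)) := by
    exact (psi L).toContinuousLinearEquiv.isOpenMap _ ho
  refine ⟨isMaximalCone_of_isOpen eq_of_mem_secondaryFan ?_ ho' (hne.image _),
    isMaximalCone_of_isOpen eq_of_mem_groebnerFan ?_ ho' (hne.image _),
    isMaximalCone_of_isOpen eq_of_mem_groebnerFan ⟨hne, _, rfl⟩ ho hne⟩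
  · rw [groebnerCone_hibiIdeal]
    exact ⟨_, ⟨_, regularSubdivision_psi hw⟩, secondaryCone_chainTriangulation.symm⟩
  · exact ⟨hne.image _, _, groebnerCone_toricIdeal.symm⟩
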